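/- \textbf{Symmetry extension lemma.} Let $S^{n-1}$ be the unit sphere of Euclidean space $\mathbb{R}^n$ with origin $o$, and let $O(n)$ be its group of linear isometries. For a subspace $K$ of $\mathbb{R}^n$, let $O(n)_K$ be the subgroup of all $\phi\in O(n)$ with $\phi x=x$ for every $x\in K$, and let $R_K$ be the reflection $R_K x=2(x|K)-x$ in $K$, where $x|K$ denotes the orthogonal projection of $x$ onto $K$. A set $X\subset\mathbb{R}^n$ is called invariant under $\phi\in O(n)$ if $\phi X=X$. Let $H$ and $L$ be subspaces of $\mathbb{R}^n$ such that $H\cap L^\perp=\{o\}$ and $\dim H<\dim L$. If $E\subset S^{n-1}$ is nonempty, closed, and invariant under $R_H$ and under every element of $O(n)_{L^\perp}$, then $E$ is invariant under every element of $O(n)_{(H+L)^\perp}$. The same conclusion holds if invariance under $R_H$ is replaced by invariance under $R_{H^\perp}$. -/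

import Mathlib

/-- `O(n)`: the group of linear isometries of Euclidean space `ℝⁿ`. -/
abbrev OrthogonalGroupRn (n : ℕ) : Type :=
  EuclideanSpace ℝ (Fin n) ≃ₗᵢ[ℝ] EuclideanSpace ℝ (Fin n)

/-- `O(n)_K`: the pointwise stabilizer of the subspace `K` in `O(n)`. -/
def orthogonalStabilizer (n : ℕ) (K : Submodule ℝ (EuclideanSpace ℝ (Fin n))) :
    Subgroup (OrthogonalGroupRn n) where
  carrier := {φ | ∀ x ∈ K, φ x = x}
  one_mem' := fun _ _ => rfl
  mul_mem' := by
    intro φ ψ hφ hψ x hx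
    rw [LinearIsometryEquiv.coe_mul, Function.comp_apply, hψ x hx, hφ x hx]
  inv_mem' := by
    intro φ hφ x hx
    exact (LinearIsometryEquiv.symm_apply_eq φ).2 (hφ x hx).symm

/-- The reflection `R_K` in the subspace `K`, the map `x ↦ 2 (x | K) - x`, where `x | K` is the
orthogonal projection of `x` onto `K`, as an element of `O(n)`. -/
noncomputable def reflectionIn {n : ℕ} (K : Submodule ℝ (EuclideanSpace ℝ (Fin n))) :
    OrthogonalGroupRn n :=
  K.reflection

theorem reflectionIn_apply {n : ℕ} (K : Submodule ℝ (EuclideanSpace ℝ (Fin n)))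
    (x : EuclideanSpace ℝ (Fin n)) :
    reflectionIn K x = (2 : ℝ) • K.starProjection x - x := by
  rw [reflectionIn, Submodule.reflection_apply, two_smul, two_smul]

/-- The set `X` is invariant under `φ`, i.e. `φ X = X`. -/
def InvariantUnder {n : ℕ} (φ : OrthogonalGroupRn n) (X : Set (EuclideanSpace ℝ (Fin n))) : Prop :=
  φ '' X = X

open Submodule

/-! Let `G` be the group of isometries preserving `E`, and `S` the set of vectors whose hyperplane
reflection lies in `G`. `S` contains `L`, and, being stable under `G`, also `M = R_H L`. As `dim H <
dim L`, some nonzero vector of `L` is orthogonal to `H`; `R_H` negates it, so `L ⊓ M ≠ ⊥`. This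
overlap forces `L ⊔ M ⊆ S` (`sup_subset_reflectionVectors`), and `H ⊔ L ≤ L ⊔ M`. Reflections along
`H ⊔ L` generate every isometry fixing its complement (`mem_of_fixes_orthogonal`). -/

section ReflectionVectors

variable {F : Type*} [NormedAddCommGroup F] [InnerProductSpace ℝ F]

/-- The vectors whose associated hyperplane reflection belongs to the group `G`. -/
def reflectionVectors (G : Subgroup (F ≃ₗᵢ[ℝ] F)) : Set F :=
  {v | (ℝ ∙ v)ᗮ.reflection ∈ G}

theorem reflection_hyperplane_apply (v x : F) :
    (ℝ ∙ v)ᗮ.reflection x = x - (2 * (inner ℝ v x / ‖v‖ ^ 2)) • v := by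
  rw [reflection_orthogonal_apply, reflection_singleton_apply, two_mul, add_smul, two_nsmul]
  simp

theorem map_mem_reflectionVectors {G : Subgroup (F ≃ₗᵢ[ℝ] F)} {g : F ≃ₗᵢ[ℝ] F} (hg : g ∈ G)
    {v : F} (hv : v ∈ reflectionVectors G) : g v ∈ reflectionVectors G := by
  have h : (ℝ ∙ g v)ᗮ.reflection = g * (ℝ ∙ v)ᗮ.reflection * g⁻¹ := by
    ext x
    have hx : inner ℝ (g v) x = inner ℝ v (g⁻¹ x) := by
      conv_lhs => rw [← LinearIsometryEquiv.apply_symm_apply g x]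
      exact g.inner_map_map _ _
    have hgx : g (g⁻¹ x) = x := g.apply_symm_apply x
    simp only [LinearIsometryEquiv.coe_mul, Function.comp_apply, reflection_hyperplane_apply,
      map_sub, map_smul, hx, hgx, LinearIsometryEquiv.norm_map]
  change _ ∈ G
  rw [h]
  exact G.mul_mem (G.mul_mem hg hv) (G.inv_mem hg)

theorem smul_mem_reflectionVectors_iff {G : Subgroup (F ≃ₗᵢ[ℝ] F)} {c : ℝ} (hc : c ≠ 0) {v : F} :
    c • v ∈ reflectionVectors G ↔ v ∈ reflectionVectors G := by
  have h : (ℝ ∙ c • v) = ℝ ∙ v := span_singleton_smul_eq (IsUnit.mk0 c hc) v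
  simp only [reflectionVectors, Set.mem_ofPred_eq, h]

theorem sub_smul_mem_reflectionVectors {G : Subgroup (F ≃ₗᵢ[ℝ] F)} {u v : F}
    (hu : u ∈ reflectionVectors G) (hv : v ∈ reflectionVectors G) (hn : ‖v‖ = 1) :
    u - (2 * inner ℝ v u) • v ∈ reflectionVectors G := by
  have h := map_mem_reflectionVectors (G := G) hv hu
  rwa [reflection_hyperplane_apply, hn, one_pow, div_one] at h

/-- A height `h` is attained when every unit vector over `L` with `b`-coordinate `h` is a
reflection vector of `G`. -/
def AttainedHeight (G : Subgroup (F ≃ₗᵢ[ℝ] F)) (L : Submodule ℝ F) (b : F) (h : ℝ) : Prop :=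
  ∀ a ∈ L, ‖a‖ ^ 2 + h ^ 2 = 1 → a + h • b ∈ reflectionVectors G

variable {G : Subgroup (F ≃ₗᵢ[ℝ] F)} {L : Submodule ℝ F} {b : F}

/-- Reflection along `a - a'`, a vector of `L`, carries `a` to `a'` and fixes `b`; so one vector of
a given height yields all. -/
theorem attainedHeight_of_mem (hL : ∀ v ∈ L, v ∈ reflectionVectors G) (hb : b ∈ Lᗮ) {h : ℝ}
    {a : F} (ha : a ∈ L) (hn : ‖a‖ ^ 2 + h ^ 2 = 1) (hS : a + h • b ∈ reflectionVectors G) :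
    AttainedHeight G L b h := by
  intro a' ha' hn'
  have hnorm : ‖a‖ = ‖a'‖ := by
    have : ‖a‖ ^ 2 = ‖a'‖ ^ 2 := by linarith
    exact (sq_eq_sq₀ (norm_nonneg _) (norm_nonneg _)).1 this
  have h1 := map_mem_reflectionVectors (hL _ (L.sub_mem ha ha')) hS
  have h2 : (ℝ ∙ (a - a'))ᗮ.reflection b = b := by
    apply reflection_mem_subspace_eq_self
    rw [mem_orthogonal_singleton_iff_inner_right]
    exact hb _ (L.sub_mem ha ha')
  rwa [map_add, map_smul, h2, reflection_sub hnorm] at h1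

theorem norm_add_smul_sq_of_mem_orthogonal (hb : b ∈ Lᗮ) (hb1 : ‖b‖ = 1) {a : F} (ha : a ∈ L)
    (h : ℝ) : ‖a + h • b‖ ^ 2 = ‖a‖ ^ 2 + h ^ 2 := by
  rw [norm_add_sq_real, inner_smul_right, hb a ha, norm_smul, hb1]
  simp

/-- Reflecting `u` along a unit vector of height `h` gives height `-2ch`, where `c` is their inner
product. With `h = sin θ`, this reaches every height up to `|sin 2θ|`. -/
theorem AttainedHeight.of_sq_le (hL : ∀ v ∈ L, v ∈ reflectionVectors G)
    (hb : b ∈ Lᗮ) (hb1 : ‖b‖ = 1) {u u' : F} (hu : u ∈ L) (hu' : u' ∈ L)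
    (hu1 : ‖u‖ = 1) (hu1' : ‖u'‖ = 1) (huu' : inner ℝ u u' = 0) {h k : ℝ} (h0 : h ≠ 0)
    (hT : AttainedHeight G L b h) (hk : k ^ 2 ≤ 4 * h ^ 2 * (1 - h ^ 2)) :
    AttainedHeight G L b k := by
  obtain ⟨c, hc⟩ : ∃ c : ℝ, k = -(2 * c * h) := ⟨-k / (2 * h), by field_simp⟩
  have hc2 : c ^ 2 ≤ 1 - h ^ 2 := by
    have : 0 < 4 * h ^ 2 := by positivity
    rw [hc] at hk
    refine le_of_mul_le_mul_left ?_ this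
    linarith
  -- The second direction `u'` absorbs the rest of the norm, leaving `c` free.
  set d := √(1 - h ^ 2 - c ^ 2)
  have hd : d ^ 2 = 1 - h ^ 2 - c ^ 2 := Real.sq_sqrt (by linarith)
  have ha : c • u + d • u' ∈ L := L.add_mem (L.smul_mem _ hu) (L.smul_mem _ hu')
  have han : ‖c • u + d • u'‖ ^ 2 + h ^ 2 = 1 := by
    rw [norm_add_sq_real, inner_smul_left, inner_smul_right, huu', norm_smul, norm_smul, hu1, hu1']
    simp only [Real.norm_eq_abs, mul_one, sq_abs, mul_zero]
    linarith
  have hvS := hT _ ha han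
  have hvn : ‖c • u + d • u' + h • b‖ = 1 := by
    rw [← norm_add_smul_sq_of_mem_orthogonal hb hb1 ha] at han
    exact (pow_eq_one_iff_of_nonneg (norm_nonneg _) two_ne_zero).1 han
  have hin : inner ℝ (c • u + d • u' + h • b) u = c := by
    have hbu : inner ℝ b u = 0 := by rw [real_inner_comm]; exact hb u hu
    have huu : inner ℝ u' u = 0 := by rw [real_inner_comm]; exact huu'
    rw [inner_add_left, inner_add_left, inner_smul_left, inner_smul_left, inner_smul_left, hbu,
      huu, real_inner_self_eq_norm_sq, hu1]
    simp
  have hS := sub_smul_mem_reflectionVectors (hL u hu) hvS hvn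
  have hnorm : ‖u - (2 * c) • (c • u + d • u' + h • b)‖ = 1 := by
    have h3 := (ℝ ∙ (c • u + d • u' + h • b))ᗮ.reflection.norm_map u
    rwa [reflection_hyperplane_apply, hvn, one_pow, div_one, hin, hu1] at h3
  rw [hin] at hS
  have heq : u - (2 * c) • (c • u + d • u' + h • b) =
      (u - (2 * c) • (c • u + d • u')) + k • b := by
    rw [hc]; module
  rw [heq] at hS hnorm
  have hm : u - (2 * c) • (c • u + d • u') ∈ L := L.sub_mem hu (L.smul_mem _ ha)
  refine attainedHeight_of_mem hL hb hm ?_ hS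
  rw [← norm_add_smul_sq_of_mem_orthogonal hb hb1 hm, hnorm, one_pow]

theorem AttainedHeight.all (hL : ∀ v ∈ L, v ∈ reflectionVectors G)
    (hb : b ∈ Lᗮ) (hb1 : ‖b‖ = 1) {u u' : F} (hu : u ∈ L) (hu' : u' ∈ L)
    (hu1 : ‖u‖ = 1) (hu1' : ‖u'‖ = 1) (huu' : inner ℝ u u' = 0) {h : ℝ} (h0 : h ≠ 0)
    (h1 : h ^ 2 < 1) (hT : AttainedHeight G L b h) {k : ℝ} (hk : k ^ 2 ≤ 1) :
    AttainedHeight G L b k := by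
  have step : ∀ {h k : ℝ}, h ≠ 0 → AttainedHeight G L b h →
      k ^ 2 ≤ 4 * h ^ 2 * (1 - h ^ 2) → AttainedHeight G L b k := fun h0 hT hk =>
    hT.of_sq_le hL hb hb1 hu hu' hu1 hu1' huu' h0 hk
  -- For `h ≤ 1/2` the bound is at least `3h² ≥ (3h/2)²`, so heights grow by a factor `3/2` until
  -- `1/2` is reached.
  have grow : ∀ m : ℕ, ∀ h : ℝ, 0 < h → h ≤ 1 / 2 → AttainedHeight G L b h →
      1 / 2 ≤ (3 / 2) ^ m * h → AttainedHeight G L b (1 / 2) := by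
    intro m
    induction m with
    | zero =>
      intro h _ hle hT hm
      rw [pow_zero, one_mul] at hm
      rwa [← le_antisymm hle hm]
    | succ m ih =>
      intro h hpos hle hT hm
      have hh : h ^ 2 ≤ 1 / 4 := by nlinarith
      have hh' : 3 * h ^ 2 ≤ 4 * h ^ 2 * (1 - h ^ 2) := by nlinarith [sq_nonneg h]
      by_cases hc : 3 / 2 * h ≤ 1 / 2
      · refine ih (3 / 2 * h) (by positivity) hc (step hpos.ne' hT ?_) ?_
        · nlinarith [sq_nonneg h]
        · calc (1 : ℝ) / 2 ≤ (3 / 2) ^ (m + 1) * h := hm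
            _ = _ := by ring
      · refine step hpos.ne' hT ?_
        nlinarith
  have half : AttainedHeight G L b (1 / 2) := by
    have hpos : 0 < 4 * h ^ 2 * (1 - h ^ 2) := by
      have : 0 < h ^ 2 := by positivity
      have : 0 < 1 - h ^ 2 := by linarith
      positivity
    set k := min (1 / 2) √(4 * h ^ 2 * (1 - h ^ 2))
    have hk0 : 0 < k := lt_min (by norm_num) (Real.sqrt_pos.2 hpos)
    have hkT : AttainedHeight G L b k := by
      refine step h0 hT ?_
      calc k ^ 2 ≤ √(4 * h ^ 2 * (1 - h ^ 2)) ^ 2 := pow_le_pow_left₀ hk0.le (min_le_right _ _) 2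
        _ = _ := Real.sq_sqrt hpos.le
    obtain ⟨m, hm⟩ := pow_unbounded_of_one_lt (1 / 2 / k) (by norm_num : (1 : ℝ) < 3 / 2)
    exact grow m k hk0 (min_le_left _ _) hkT ((div_lt_iff₀ hk0).1 hm).le
  have hs : √(1 / 2 : ℝ) ^ 2 = 1 / 2 := Real.sq_sqrt (by norm_num)
  -- At `h² = 1/2` the bound `4h²(1 - h²)` equals 1, so one more step gives all heights.
  have hsqrt : AttainedHeight G L b √(1 / 2) := step (by norm_num) half (by rw [hs]; norm_num)
  refine step (by positivity) hsqrt ?_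
  rw [hs]
  linarith

theorem exists_orthonormal_pair [FiniteDimensional ℝ L] (h2 : 2 ≤ Module.finrank ℝ L) :
    ∃ u ∈ L, ∃ u' ∈ L, ‖u‖ = 1 ∧ ‖u'‖ = 1 ∧ inner ℝ u u' = 0 := by
  let B := stdOrthonormalBasis ℝ L
  let i : Fin (Module.finrank ℝ L) := ⟨0, by omega⟩
  let j : Fin (Module.finrank ℝ L) := ⟨1, by omega⟩
  have hij : i ≠ j := by simp [i, j]
  exact ⟨B i, (B i).2, B j, (B j).2, B.orthonormal.1 i, B.orthonormal.1 j,
    B.orthonormal.2 hij⟩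

theorem sup_span_singleton_subset_reflectionVectors [FiniteDimensional ℝ L]
    (h2 : 2 ≤ Module.finrank ℝ L) (hL : ∀ v ∈ L, v ∈ reflectionVectors G) {w : F}
    (hw : w ∈ reflectionVectors G) (hwL : w ∉ L) (hwL' : w ∉ Lᗮ) :
    ∀ v ∈ L ⊔ ℝ ∙ w, v ∈ reflectionVectors G := by
  obtain ⟨u, hu, u', hu', hu1, hu1', huu'⟩ := exists_orthonormal_pair h2
  obtain ⟨a, ha, b', hb', rfl⟩ := L.exists_add_mem_mem_orthogonal w
  have ha0 : a ≠ 0 := by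
    rintro rfl
    exact hwL' (by simpa using hb')
  have hb0 : b' ≠ 0 := by
    rintro rfl
    exact hwL (by simpa using ha)
  set b : F := ‖b'‖⁻¹ • b'
  have hb : b ∈ Lᗮ := Lᗮ.smul_mem _ hb'
  have hb1 : ‖b‖ = 1 := norm_smul_inv_norm hb0
  have hbb' : b' = ‖b'‖ • b := by
    rw [smul_inv_smul₀ (norm_ne_zero_iff.2 hb0)]
  have normalize : ∀ x ∈ L, ∀ t : ℝ, x + t • b ≠ 0 → ‖‖x + t • b‖⁻¹ • x‖ ^ 2 +
      (‖x + t • b‖⁻¹ * t) ^ 2 = 1 := by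
    intro x hx t h0
    have h0' := norm_ne_zero_iff.2 h0
    rw [norm_smul, norm_inv, norm_norm, mul_pow, mul_pow, ← mul_add,
      ← norm_add_smul_sq_of_mem_orthogonal hb hb1 hx, ← mul_pow, inv_mul_cancel₀ h0', one_pow]
  have hw0 : a + ‖b'‖ • b ≠ 0 := by
    rw [← hbb']
    rintro h
    exact hwL (h ▸ L.zero_mem)
  have hr := inv_ne_zero (norm_ne_zero_iff.2 hw0)
  have hn := normalize a ha ‖b'‖ hw0
  have hheight : AttainedHeight G L b (‖a + ‖b'‖ • b‖⁻¹ * ‖b'‖) := by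
    refine attainedHeight_of_mem hL hb (L.smul_mem _ ha) hn ?_
    rw [mul_smul, ← smul_add, smul_mem_reflectionVectors_iff hr, ← hbb']
    exact hw
  have hlt : (‖a + ‖b'‖ • b‖⁻¹ * ‖b'‖) ^ 2 < 1 := by
    have : 0 < ‖‖a + ‖b'‖ • b‖⁻¹ • a‖ := norm_pos_iff.2 (smul_ne_zero hr ha0)
    have := pow_pos this 2
    linarith
  intro v hv
  obtain ⟨x, hx, y, hy, rfl⟩ := mem_sup.1 hv
  obtain ⟨c, rfl⟩ := mem_span_singleton.1 hy
  have hv' : x + c • (a + b') = (x + c • a) + (c * ‖b'‖) • b := by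
    conv_lhs => rw [hbb']
    module
  rw [hv']
  have hxa : x + c • a ∈ L := L.add_mem hx (L.smul_mem _ ha)
  by_cases h0 : (x + c • a) + (c * ‖b'‖) • b = 0
  · rw [h0]
    exact hL 0 L.zero_mem
  have hnv := normalize _ hxa _ h0
  have hall := hheight.all hL hb hb1 hu hu' hu1 hu1' huu'
    (mul_ne_zero hr (norm_ne_zero_iff.2 hb0)) hlt
    (by linarith [sq_nonneg ‖‖(x + c • a) + (c * ‖b'‖) • b‖⁻¹ • (x + c • a)‖])
    _ (L.smul_mem _ hxa) hnv
  rwa [mul_smul _ (c * ‖b'‖), ← smul_add,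
    smul_mem_reflectionVectors_iff (inv_ne_zero (norm_ne_zero_iff.2 h0))] at hall

/-- Take `K ≥ L` maximal inside the reflection vectors. A vector of `M` not orthogonal to `K` must
lie in `K`, else `K` could be enlarged; an orthogonal one is first shifted by a common vector `e`.
-/
theorem sup_subset_reflectionVectors [FiniteDimensional ℝ F] (h2 : 2 ≤ Module.finrank ℝ L)
    (hL : ∀ v ∈ L, v ∈ reflectionVectors G) {M : Submodule ℝ F}
    (hM : ∀ v ∈ M, v ∈ reflectionVectors G) (hLM : L ⊓ M ≠ ⊥) :
    ∀ v ∈ L ⊔ M, v ∈ reflectionVectors G := by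
  obtain ⟨K, ⟨hLK, hK⟩, hmax⟩ := (wellFounded_gt (α := Submodule ℝ F)).has_min
    {K : Submodule ℝ F | L ≤ K ∧ ∀ v ∈ K, v ∈ reflectionVectors G} ⟨L, le_rfl, hL⟩
  obtain ⟨e, he, he0⟩ := exists_mem_ne_zero_of_ne_bot hLM
  have hK2 : 2 ≤ Module.finrank ℝ K := h2.trans (finrank_mono hLK)
  have hperp : ∀ w ∈ M, w ∉ Kᗮ → w ∈ K := by
    intro w hw hwK
    by_contra hwK'
    refine hmax (K ⊔ ℝ ∙ w) ⟨hLK.trans le_sup_left,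
      sup_span_singleton_subset_reflectionVectors hK2 hK (hM w hw) hwK' hwK⟩
      (lt_of_le_of_ne le_sup_left fun h => hwK' ?_)
    rw [h]
    exact mem_sup_right (mem_span_singleton_self w)
  have heK : e ∈ K := hLK he.1
  have hMK : M ≤ K := by
    intro w hw
    by_cases hwK : w ∈ Kᗮ
    · have h := hperp (w + e) (M.add_mem hw he.2) fun h => he0 <| by
        have h' : e ∈ Kᗮ := by simpa using Kᗮ.sub_mem h hwK
        exact inner_self_eq_zero.1 (h' e heK)
      simpa using K.sub_mem h heK
    · exact hperp w hw hwK
  exact fun v hv => hK v (sup_le hLK hMK hv)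

/-- An isometry fixing `Vᗮ` pointwise is a product of hyperplane reflections along vectors
of `V`. -/
theorem mem_of_fixes_orthogonal [FiniteDimensional ℝ F] (V : Submodule ℝ F)
    (hV : ∀ v ∈ V, v ∈ reflectionVectors G) (φ : F ≃ₗᵢ[ℝ] F) (hφ : ∀ x ∈ Vᗮ, φ x = x) :
    φ ∈ G := by
  induction hd : Module.finrank ℝ V using Nat.strong_induction_on generalizing V φ with
  | _ d ih =>
    by_cases hbot : V = ⊥
    · have : φ = 1 := by
        ext1 x
        exact hφ x (by simp [hbot])
      exact this ▸ G.one_mem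
    obtain ⟨v, hv, hv0⟩ := exists_mem_ne_zero_of_ne_bot hbot
    have hφv : φ v ∈ V := by
      rw [← V.orthogonal_orthogonal]
      intro x hx
      rw [← hφ x hx, φ.inner_map_map, real_inner_comm]
      exact hx v hv
    -- `ρ` returns `φ v` to `v` and fixes `Vᗮ`, so `ρ * φ` also fixes `v` and `V` shrinks to `V ⊓ (ℝ
    -- ∙ v)ᗮ`.
    set ρ := (ℝ ∙ (φ v - v))ᗮ.reflection
    have hρ : ρ ∈ G := hV _ (V.sub_mem hφv hv)
    have hρφ : ρ * φ ∈ G := by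
      refine ih (Module.finrank ℝ (V ⊓ (ℝ ∙ v)ᗮ : Submodule ℝ F)) ?_ (V ⊓ (ℝ ∙ v)ᗮ)
        (fun x hx => hV x hx.1) (ρ * φ) ?_ rfl
      · rw [← hd]
        refine finrank_lt_finrank_of_lt (lt_of_le_of_ne inf_le_left fun h => hv0 ?_)
        have hvv : v ∈ (ℝ ∙ v)ᗮ := inf_eq_left.1 h hv
        rw [mem_orthogonal_singleton_iff_inner_right] at hvv
        exact inner_self_eq_zero.1 hvv
      · have hsup : (V ⊓ (ℝ ∙ v)ᗮ)ᗮ = Vᗮ ⊔ ℝ ∙ v := by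
          rw [← orthogonal_orthogonal (Vᗮ ⊔ ℝ ∙ v), ← inf_orthogonal, orthogonal_orthogonal]
        intro x hx
        rw [hsup] at hx
        obtain ⟨y, hy, z, hz, rfl⟩ := mem_sup.1 hx
        obtain ⟨c, rfl⟩ := mem_span_singleton.1 hz
        have hρv : ρ (φ v) = v := reflection_sub (φ.norm_map v)
        have hρy : ρ y = y := by
          apply reflection_mem_subspace_eq_self
          rw [mem_orthogonal_singleton_iff_inner_right]
          exact hy _ (V.sub_mem hφv hv)
        rw [LinearIsometryEquiv.coe_mul, Function.comp_apply, map_add, map_add, map_smul, map_smul,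
          hρv, hφ y hy, hρy]
    exact (G.mul_mem_cancel_left hρ).1 hρφ

end ReflectionVectors

/-! ### Application to the invariance group of `E` -/

/-- The group of linear isometries leaving `E` invariant. -/
def invarianceGroup {n : ℕ} (E : Set (EuclideanSpace ℝ (Fin n))) :
    Subgroup (OrthogonalGroupRn n) where
  carrier := {φ | InvariantUnder φ E}
  one_mem' := by simp [InvariantUnder]
  mul_mem' := by
    intro φ ψ hφ hψ
    change (φ * ψ : OrthogonalGroupRn n) '' E = E
    rw [LinearIsometryEquiv.coe_mul, Set.image_comp, hψ, hφ]
  inv_mem' := by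
    intro φ hφ
    change (φ⁻¹ : OrthogonalGroupRn n) '' E = E
    conv_lhs => rw [← show φ '' E = E from hφ]
    rw [← Set.image_comp, ← LinearIsometryEquiv.coe_mul, inv_mul_cancel,
      LinearIsometryEquiv.coe_one, Set.image_id]

theorem mainTheorem2 (n : ℕ) (H L : Submodule ℝ (EuclideanSpace ℝ (Fin n)))
    (hHL : H ⊓ Lᗮ = ⊥)
    (hdim : Module.finrank ℝ H < Module.finrank ℝ L)
    (E : Set (EuclideanSpace ℝ (Fin n)))
    (hEsub : E ⊆ Metric.sphere (0 : EuclideanSpace ℝ (Fin n)) 1)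
    (hEne : E.Nonempty)
    (hEclosed : IsClosed E)
    (hrefl : InvariantUnder (reflectionIn H) E ∨ InvariantUnder (reflectionIn Hᗮ) E)
    (hrot : ∀ φ ∈ orthogonalStabilizer n Lᗮ, InvariantUnder φ E) :
    ∀ φ ∈ orthogonalStabilizer n (H ⊔ L)ᗮ, InvariantUnder φ E := by
  by_cases hH : H = ⊥
  · rwa [hH, bot_sup_eq]
  have h2 : 2 ≤ Module.finrank ℝ L := by
    have := Submodule.one_le_finrank_iff.2 hH
    omega
  have hL : ∀ v ∈ L, v ∈ reflectionVectors (invarianceGroup E) := by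
    refine fun v hv => hrot _ fun x hx => reflection_mem_subspace_eq_self ?_
    rw [mem_orthogonal_singleton_iff_inner_right]
    exact hx v hv
  have hRv : ∀ v ∈ L, H.reflection v ∈ reflectionVectors (invarianceGroup E) := by
    intro v hv
    rcases hrefl with h | h
    · exact map_mem_reflectionVectors (G := invarianceGroup E) h (hL v hv)
    -- The reflection in `Hᗮ` is `-R_H`, and opposite vectors have the same hyperplane reflection.
    · have := map_mem_reflectionVectors (G := invarianceGroup E) h (hL v hv)
      rwa [reflectionIn, reflection_orthogonal_apply, ← neg_one_smul ℝ,
        smul_mem_reflectionVectors_iff (by norm_num)] at this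
  set M := L.map (H.reflection.toLinearEquiv : _ →ₗ[ℝ] EuclideanSpace ℝ (Fin n))
  have hM : ∀ v ∈ M, v ∈ reflectionVectors (invarianceGroup E) := by
    rintro _ ⟨v, hv, rfl⟩
    exact hRv v hv
  have hmeet : L ⊓ M ≠ ⊥ := by
    have hpos : L ⊓ Hᗮ ≠ ⊥ := by
      intro h
      have h1 := Submodule.finrank_add_finrank_le_of_disjoint (disjoint_iff.2 h)
      have h3 := H.finrank_add_finrank_orthogonal
      omega
    obtain ⟨e, he, he0⟩ := exists_mem_ne_zero_of_ne_bot hpos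
    refine (Submodule.ne_bot_iff _).2 ⟨e, ⟨he.1, -e, L.neg_mem he.1, ?_⟩, he0⟩
    change H.reflection (-e) = e
    rw [map_neg, reflection_mem_subspace_orthogonalComplement_eq_neg he.2, neg_neg]
  have hsup : H ⊔ L ≤ L ⊔ M := by
    refine sup_le ?_ le_sup_left
    -- The projection of `v` onto `H` is the mean of `v` and `R_H v`. These projections fill `H`: a
    -- vector of `H` orthogonal to them all lies in `H ⊓ Lᗮ`.
    have hproj : L.map (H.starProjection : _ →ₗ[ℝ] EuclideanSpace ℝ (Fin n)) ≤ L ⊔ M := by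
      rintro _ ⟨v, hv, rfl⟩
      have h1 : H.starProjection v = (2 : ℝ)⁻¹ • (v + H.reflection v) := by
        rw [reflection_apply, two_nsmul]
        module
      change H.starProjection v ∈ _
      rw [h1]
      exact smul_mem _ _ (add_mem (mem_sup_left hv) (mem_sup_right ⟨v, hv, rfl⟩))
    refine le_trans ?_ hproj
    set P := L.map (H.starProjection : _ →ₗ[ℝ] EuclideanSpace ℝ (Fin n))
    have hPH : P ≤ H := by
      rintro _ ⟨v, _, rfl⟩
      exact H.starProjection_apply_mem v
    have hperp : Pᗮ ⊓ H = ⊥ := by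
      rw [eq_bot_iff, ← hHL]
      rintro x ⟨hxP, hxH⟩
      refine ⟨hxH, fun v hv => ?_⟩
      have h1 : inner ℝ (H.starProjection v) x = 0 := hxP _ ⟨v, hv, rfl⟩
      rwa [H.inner_starProjection_left_eq_right,
        H.starProjection_eq_self_iff.2 hxH] at h1
    have := Submodule.sup_orthogonal_inf_of_hasOrthogonalProjection hPH
    rw [hperp, sup_bot_eq] at this
    exact this.ge
  intro φ hφ
  exact mem_of_fixes_orthogonal (G := invarianceGroup E) (H ⊔ L)
    (fun v hv => sup_subset_reflectionVectors h2 hL hM hmeet v (hsup hv)) φ hφ
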